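/- Let $k$ be an algebraically closed field of characteristic zero and let $(R,\mathfrak m)$ be an artinian Gorenstein local $k$-algebra that is not a field (Gorenstein meaning that $R$ has finite injective dimension as an $R$-module). If the length $\ell(R)$ of $R$ as an $R$-module is at most $7$, then $R$ is exact, that is, $$\sup\{\mu(\mathfrak a) : \mathfrak a \text{ an ideal of } R,\ \mathfrak a\subseteq\mathfrak m\}=\inf\{\ell(R/xR) : x\in\mathfrak m\},$$ where $\mu(\mathfrak a)$ denotes the minimal number of generators of $\mathfrak a$. -/

import Mathlib

/-- A noetherian local ring is Gorenstein if it has finite injective dimension as a module over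
itself. -/
def IsGorensteinLocalRing (R : Type*) [CommRing R] [IsLocalRing R] [IsNoetherianRing R] : Prop :=
  ∃ n : ℕ, CategoryTheory.HasInjectiveDimensionLE (ModuleCat.of R R) n

namespace IsLocalRing

/-- `μ(I)`, the minimal number of generators of an ideal. -/
noncomputable def minGenerators {R : Type*} [CommRing R] (I : Ideal R) : ℕ∞ :=
  Cardinal.toENat I.spanRank

/-- The Dilworth number `sup {μ(I) : I ⊆ 𝔪}`. -/
noncomputable def dilworthNumber (R : Type*) [CommRing R] [IsLocalRing R] : ℕ∞ :=
  ⨆ (I : Ideal R) (_ : I ≤ maximalIdeal R), minGenerators I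

/-- The Rees number `inf {ℓ(R / xR) : x ∈ 𝔪}`. -/
noncomputable def reesNumber (R : Type*) [CommRing R] [IsLocalRing R] : ℕ∞ :=
  ⨅ (x : R) (_ : x ∈ maximalIdeal R), Module.length R (R ⧸ Ideal.span {x})

/-- A local ring is exact if its Dilworth number equals its Rees number. -/
def IsExact (R : Type*) [CommRing R] [IsLocalRing R] : Prop :=
  dilworthNumber R = reesNumber R

end IsLocalRing

/-!
The inequality `sup μ ≤ inf ℓ(R / xR)` holds in every artinian local ring, because
`μ(I) = ℓ(I / 𝔪I) ≤ ℓ(I / xI) ≤ ℓ(R / xR)` for `x ∈ 𝔪`, and equality follows once some nonzero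
`x ∈ 𝔪` satisfies `x𝔪 = 𝔪²`, since then `ℓ(R / xR) ≤ ℓ(𝔪 / 𝔪²) = μ(𝔪)`.

Finite injective dimension forces an artinian local ring `R` to be self-injective: the residue
field embeds into `R`, so dimension shifting turns the vanishing of `Extⁱ⁺¹` into that of `Extⁱ`.
Hence the socle is simple and `ℓ(I) + ℓ(0 : I) = ℓ(R)`. For `ℓ(R) ≤ 7` this duality leaves three
cases: `𝔪 / 𝔪²` or `𝔪² / 𝔪³` has length at most one, or modulo an ideal `J` with `J𝔪 ⊆ 𝔪³` the
ideal `𝔪` is generated by two elements `a`, `b` while `ℓ(𝔪² / 𝔪³) ≤ 2`. In the last case one of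
`a`, `b`, `a + b` can be taken for `x`.
-/

open CategoryTheory Abelian IsLocalRing

section SelfInjective

universe u

variable {R : Type u} [CommRing R]

lemma baer_of_subsingleton_ext_one (X : Type u) [AddCommGroup X] [Module R X]
    (hX : ∀ I : Ideal R, Subsingleton (Ext (ModuleCat.of R (R ⧸ I)) (ModuleCat.of R X) 1)) :
    Module.Baer R X := by
  intro I g
  have hS := ModuleCat.shortComplex_shortExact
    (ModuleCat.shortComplexOfCompEqZero I.subtype I.mkQ
      (LinearMap.exact_subtype_mkQ I).linearMap_comp_eq_zero)
    (LinearMap.exact_subtype_mkQ I) I.subtype_injective I.mkQ_surjective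
  obtain ⟨e, he⟩ := Ext.contravariant_sequence_exact₁ hS _ (Ext.mk₀ (ModuleCat.ofHom g))
    (add_zero 1) ((hX I).elim _ _)
  obtain ⟨φ, rfl⟩ := (Ext.mk₀_bijective _ _).2 e
  rw [Ext.mk₀_comp_mk₀] at he
  have hφ := ModuleCat.hom_ext_iff.mp ((Ext.mk₀_bijective _ _).1 he)
  exact ⟨φ.hom, fun a ha ↦ LinearMap.congr_fun hφ ⟨a, ha⟩⟩

lemma mem_span_singleton_of_injective (hR : Module.Injective R R) {s t : R}
    (hst : ∀ a, a * s = 0 → a * t = 0) : t ∈ Ideal.span {s} := by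
  let K : Ideal R := LinearMap.ker (LinearMap.toSpanSingleton R R s)
  let f : R ⧸ K →ₗ[R] R := K.liftQ (LinearMap.toSpanSingleton R R s) le_rfl
  let g : R ⧸ K →ₗ[R] R := K.liftQ (LinearMap.toSpanSingleton R R t) hst
  have hf : Function.Injective f :=
    LinearMap.ker_eq_bot.mp (Submodule.ker_liftQ_eq_bot _ _ _ le_rfl)
  obtain ⟨h, hh⟩ := hR.out f hf g
  have hs : f (Submodule.Quotient.mk 1) = s := one_smul R s
  have ht : g (Submodule.Quotient.mk 1) = t := one_smul R t
  refine Ideal.mem_span_singleton'.mpr ⟨h 1, ?_⟩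
  rw [← ht, ← hh, hs, mul_comm, ← smul_eq_mul, ← map_smul, smul_eq_mul, mul_one]

variable [IsLocalRing R] [IsArtinianRing R]

variable (R) in
lemma exists_injective_linearMap_quotient_maximalIdeal :
    ∃ f : R ⧸ maximalIdeal R →ₗ[R] R, Function.Injective f := by
  obtain ⟨p, hp⟩ := associatedPrimes.nonempty R R
  obtain ⟨_, hf⟩ := (isAssociatedPrime_iff_exists_injective_linearMap p R).mp hp
  rwa [eq_maximalIdeal (IsArtinianRing.isMaximal_of_isPrime p)] at hf

lemma subsingleton_ext_of_residueField (X : ModuleCat.{u} R) (i : ℕ)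
    (hk : Subsingleton (Ext (ModuleCat.of R (R ⧸ maximalIdeal R)) X i))
    (M : Type u) [AddCommGroup M] [Module R M] [hM : Module.Finite R M] :
    Subsingleton (Ext (ModuleCat.of R M) X i) := by
  induction hM using IsNoetherianRing.induction_on_isQuotientEquivQuotientPrime R with
  | subsingleton N =>
    refine subsingleton_of_forall_eq 0 fun e ↦ ?_
    rw [← e.mk₀_id_comp, (ModuleCat.isZero_of_subsingleton _).eq_zero_of_src (𝟙 _),
      Ext.mk₀_zero, Ext.zero_comp]
  | quotient N p φ =>
    rw [eq_maximalIdeal (IsArtinianRing.isMaximal_of_isPrime p.1)] at φ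
    refine subsingleton_of_forall_eq 0 fun e ↦ ?_
    rw [← e.mk₀_id_comp, ← φ.toModuleIso.hom_inv_id, ← Ext.mk₀_comp_mk₀_assoc,
      hk.elim (.comp _ e _) 0, Ext.comp_zero]
  | exact N₁ N₂ N₃ f g hf hg hfg h₁ h₃ =>
    have hS := ModuleCat.shortComplex_shortExact
      (ModuleCat.shortComplexOfCompEqZero f g hfg.linearMap_comp_eq_zero) hfg hf hg
    refine subsingleton_of_forall_eq 0 fun e ↦ ?_
    obtain ⟨e₃, rfl⟩ := Ext.contravariant_sequence_exact₂ hS _ e (h₁.elim _ _)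
    rw [h₃.elim e₃ 0, Ext.comp_zero]

lemma subsingleton_ext_of_succ (X : ModuleCat.{u} R) (i : ℕ)
    (hX : ∀ (M : Type u) [AddCommGroup M] [Module R M] [Module.Finite R M],
      Subsingleton (Ext (ModuleCat.of R M) X (i + 2)))
    (M : Type u) [AddCommGroup M] [Module R M] [Module.Finite R M] :
    Subsingleton (Ext (ModuleCat.of R M) X (i + 1)) := by
  refine subsingleton_ext_of_residueField X _ (subsingleton_of_forall_eq 0 fun e ↦ ?_) M
  obtain ⟨f, hf⟩ := exists_injective_linearMap_quotient_maximalIdeal R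
  have hS := ModuleCat.shortComplex_shortExact
    (ModuleCat.shortComplexOfCompEqZero f _ f.exact_map_mkQ_range.linearMap_comp_eq_zero)
    f.exact_map_mkQ_range hf (Submodule.mkQ_surjective _)
  have : Projective (ModuleCat.of R R) :=
    ModuleCat.projective_of_free (Module.Basis.singleton Unit R)
  obtain ⟨e', rfl⟩ := Ext.contravariant_sequence_exact₁ hS _ e (add_comm 1 _) ((hX _).elim _ _)
  rw [Ext.eq_zero_of_projective (P := ModuleCat.of R R) e', Ext.comp_zero]

theorem injective_of_hasInjectiveDimensionLE (X : Type u) [AddCommGroup X] [Module R X] {n : ℕ}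
    (hX : HasInjectiveDimensionLE (ModuleCat.of R X) n) : Module.Injective R X := by
  suffices h : ∀ d : ℕ, (∀ (M : Type u) [AddCommGroup M] [Module R M] [Module.Finite R M],
      Subsingleton (Ext (ModuleCat.of R M) (ModuleCat.of R X) (d + 1))) →
      ∀ (M : Type u) [AddCommGroup M] [Module R M] [Module.Finite R M],
        Subsingleton (Ext (ModuleCat.of R M) (ModuleCat.of R X) 1) from
    (baer_of_subsingleton_ext_one X fun I ↦ h n
      (fun _ ↦ HasInjectiveDimensionLT.subsingleton _ (n + 1) _ le_rfl _) _).injective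
  intro d hd
  induction d with
  | zero => exact hd
  | succ d ih => exact ih (subsingleton_ext_of_succ _ d hd)

end SelfInjective

lemma span_singleton_mul_le_sq {R : Type*} [CommRing R] {I : Ideal R} {x : R} (hx : x ∈ I) :
    Ideal.span {x} * I ≤ I ^ 2 := by
  rw [sq]
  exact Ideal.mul_mono_left ((Ideal.span_singleton_le_iff_mem I).mpr hx)

lemma sq_le_of_span_pair_sup_eq {R : Type*} [CommRing R] {a b : R} {I J N : Ideal R}
    (hI : Ideal.span {a, b} ⊔ J = I) (hJ : J * I ≤ N) (haa : a * a ∈ N) (hab : a * b ∈ N)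
    (hbb : b * b ∈ N) : I ^ 2 ≤ N := by
  have hpair : Ideal.span {a, b} * Ideal.span {a, b} ≤ N := by
    rw [Ideal.span_pair_mul_span_pair, Ideal.span_le]
    rintro _ (rfl | rfl | rfl | rfl)
    exacts [haa, hab, mul_comm a b ▸ hab, hbb]
  calc I ^ 2 = Ideal.span {a, b} * (Ideal.span {a, b} ⊔ J) ⊔ J * I := by
        rw [hI, ← Ideal.sup_mul, hI, sq]
    _ ≤ N := by
        rw [Ideal.mul_sup]
        refine sup_le (sup_le hpair ?_) hJ
        rw [mul_comm]
        exact (Ideal.mul_mono_right (hI ▸ le_sup_left)).trans hJ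

section Nakayama

variable {R : Type*} [CommRing R] [IsLocalRing R] [IsNoetherianRing R]

local notation "𝔪" => maximalIdeal R

lemma maximalIdeal_mul_lt {I : Ideal R} (hI : I ≠ ⊥) : 𝔪 * I < I := by
  refine lt_of_le_of_ne Ideal.mul_le_right fun h ↦ hI ?_
  exact Submodule.eq_bot_of_le_smul_of_le_jacobson_bot 𝔪 I (IsNoetherian.noetherian I)
    (by rw [smul_eq_mul, h]) (maximalIdeal_le_jacobson _)

lemma maximalIdeal_mul_le_of_covBy {I J : Ideal R} (h : J ⋖ I) : 𝔪 * I ≤ J := by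
  by_contra hle
  have hsup : J ⊔ 𝔪 * I = I := (h.eq_or_eq le_sup_left
    (sup_le h.le Ideal.mul_le_right)).resolve_left fun h0 ↦ hle (sup_eq_left.mp h0)
  exact h.lt.not_ge (Submodule.le_of_le_smul_of_le_jacobson_bot (IsNoetherian.noetherian I)
    (maximalIdeal_le_jacobson _) (by rw [smul_eq_mul, hsup]))

lemma span_mul_maximalIdeal_eq_of_le_sup {x : R} (hx : x ∈ 𝔪)
    (h : 𝔪 ^ 2 ≤ Ideal.span {x} * 𝔪 ⊔ 𝔪 ^ 3) : Ideal.span {x} * 𝔪 = 𝔪 ^ 2 := by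
  refine (span_singleton_mul_le_sq hx).antisymm (Submodule.le_of_le_smul_of_le_jacobson_bot
    (IsNoetherian.noetherian _) (maximalIdeal_le_jacobson _) ?_)
  rwa [smul_eq_mul, ← pow_succ']

end Nakayama

section IdealLength

variable {R : Type*} [CommRing R]

/-- The length of an ideal as a module, as a natural number; it is `0` when the length is infinite,
which does not happen over an artinian ring. -/
noncomputable def idealLength (I : Ideal R) : ℕ := (Module.length R I).toNat

local notation "ℓ" => idealLength

@[simp] lemma idealLength_bot : ℓ (⊥ : Ideal R) = 0 := by simp [idealLength]

variable [IsArtinianRing R]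

lemma coe_idealLength (I : Ideal R) : (ℓ I : ℕ∞) = Module.length R I :=
  ENat.natCast_toNat Module.length_ne_top

lemma coe_idealLength_top : (ℓ (⊤ : Ideal R) : ℕ∞) = Module.length R R := by
  rw [coe_idealLength, Module.length_top]

lemma idealLength_strictMono : StrictMono (idealLength (R := R)) := fun I J h ↦ by
  rw [← Nat.cast_lt (α := ℕ∞), coe_idealLength, coe_idealLength, Module.length_submodule,
    Module.length_submodule]
  exact Submodule.height_strictMono h

lemma idealLength_mono : Monotone (idealLength (R := R)) := idealLength_strictMono.monotone

lemma eq_of_le_of_idealLength_le {I J : Ideal R} (hIJ : I ≤ J) (h : ℓ J ≤ ℓ I) : I = J :=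
  hIJ.eq_of_not_lt fun hlt ↦ (idealLength_strictMono hlt).not_ge h

@[simp] lemma idealLength_eq_zero {I : Ideal R} : ℓ I = 0 ↔ I = ⊥ :=
  ⟨fun h ↦ (eq_of_le_of_idealLength_le bot_le (by simp [h])).symm, fun h ↦ h ▸ idealLength_bot⟩

lemma idealLength_add_length_quotient (I : Ideal R) :
    ℓ I + Module.length R (R ⧸ I) = ℓ (⊤ : Ideal R) := by
  rw [coe_idealLength, coe_idealLength_top]
  exact (Module.length_eq_add_of_exact I.subtype I.mkQ I.subtype_injective I.mkQ_surjective
    (LinearMap.exact_subtype_mkQ I)).symm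

lemma length_quotient_eq_sub (I : Ideal R) :
    Module.length R (R ⧸ I) = (ℓ (⊤ : Ideal R) - ℓ I : ℕ) := by
  rw [ENat.natCast_sub, ← idealLength_add_length_quotient I]
  exact ((ENat.addLECancellable_natCast _).add_tsub_cancel_left).symm

lemma idealLength_inf_annihilator_add_idealLength_span_mul (x : R) (I : Ideal R) :
    ℓ (I ⊓ (Ideal.span {x}).annihilator) + ℓ (Ideal.span {x} * I) = ℓ I := by
  have hmul : ∀ a ∈ I, LinearMap.lsmul R R x a ∈ Ideal.span {x} * I := fun a ha ↦
    Ideal.mul_mem_mul (Ideal.mem_span_singleton_self x) ha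
  have hsurj : Function.Surjective ((LinearMap.lsmul R R x).restrict hmul) := fun ⟨b, hb⟩ ↦ by
    obtain ⟨a, ha, rfl⟩ := Ideal.mem_span_singleton_mul.mp hb
    exact ⟨⟨a, ha⟩, rfl⟩
  have hexact : Function.Exact
      (Submodule.inclusion (inf_le_left : I ⊓ (Ideal.span {x}).annihilator ≤ I))
      ((LinearMap.lsmul R R x).restrict hmul) := by
    rintro ⟨a, ha⟩
    simp [Subtype.ext_iff, mul_comm, ha]
  rw [← Nat.cast_inj (R := ℕ∞), Nat.cast_add, coe_idealLength, coe_idealLength, coe_idealLength]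
  exact (Module.length_eq_add_of_exact _ _ (Submodule.inclusion_injective _) hsurj hexact).symm

lemma idealLength_add_idealLength_span_le (x : R) (I : Ideal R) :
    ℓ I + ℓ (Ideal.span {x}) ≤ ℓ (⊤ : Ideal R) + ℓ (Ideal.span {x} * I) := by
  have hI := idealLength_inf_annihilator_add_idealLength_span_mul x I
  have htop := idealLength_inf_annihilator_add_idealLength_span_mul x ⊤
  rw [top_inf_eq, Ideal.mul_top] at htop
  have := idealLength_mono (inf_le_right : I ⊓ (Ideal.span {x}).annihilator ≤ _)
  omega

lemma idealLength_lt_sup_span_singleton {J : Ideal R} {a : R} (ha : a ∉ J) :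
    ℓ J < ℓ (J ⊔ Ideal.span {a}) :=
  idealLength_strictMono (left_lt_sup.mpr ((Ideal.span_singleton_le_iff_mem J).not.mpr ha))

lemma exists_mem_idealLength_le_sup_span_singleton_add {I J : Ideal R} (hJI : J ≤ I) {n : ℕ}
    (hn : ℓ I ≤ ℓ J + (n + 1)) : ∃ a ∈ I, ℓ I ≤ ℓ (J ⊔ Ideal.span {a}) + n := by
  obtain rfl | hlt := hJI.eq_or_lt
  · exact ⟨0, J.zero_mem, by simp⟩
  obtain ⟨a, haI, haJ⟩ := SetLike.exists_of_lt hlt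
  have := idealLength_lt_sup_span_singleton haJ
  exact ⟨a, haI, by omega⟩

lemma sup_span_singleton_sup_span_singleton_eq {I J : Ideal R} {p q : R} (hJI : J ≤ I)
    (hp : p ∈ I) (hq : q ∈ I) (hlen : ℓ I ≤ ℓ J + 2) (hpJ : p ∉ J)
    (hqJ : q ∉ J ⊔ Ideal.span {p}) : J ⊔ Ideal.span {p} ⊔ Ideal.span {q} = I := by
  have := idealLength_lt_sup_span_singleton hpJ
  have := idealLength_lt_sup_span_singleton hqJ
  refine eq_of_le_of_idealLength_le ?_ (by omega)
  simp only [sup_le_iff, Ideal.span_singleton_le_iff_mem]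
  exact ⟨⟨hJI, hp⟩, hq⟩

end IdealLength

section LocalRing

variable {R : Type*} [CommRing R] [IsLocalRing R] [IsArtinianRing R]

local notation "𝔪" => maximalIdeal R
local notation "ℓ" => idealLength

lemma idealLength_top_eq : ℓ (⊤ : Ideal R) = ℓ 𝔪 + 1 := by
  have : IsSimpleModule R (R ⧸ 𝔪) := isSimpleModule_iff_isCoatom.mpr (maximalIdeal.isMaximal R).out
  have h := idealLength_add_length_quotient 𝔪
  rw [Module.length_eq_one] at h
  exact_mod_cast h.symm

lemma idealLength_maximalIdeal_mul_add_spanFinrank (I : Ideal R) :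
    ℓ (𝔪 * I) + I.spanFinrank = ℓ I := by
  let N : Submodule R I := 𝔪 • ⊤
  let : Module (R ⧸ 𝔪) (I ⧸ N) := inferInstanceAs (Module (R ⧸ 𝔪) (I ⧸ 𝔪 • (⊤ : Submodule R I)))
  have : IsScalarTower R (R ⧸ 𝔪) (I ⧸ N) :=
    inferInstanceAs (IsScalarTower R (R ⧸ 𝔪) (I ⧸ 𝔪 • (⊤ : Submodule R I)))
  have hmap : N.map I.subtype = 𝔪 * I := by
    rw [Submodule.map_smul'', Submodule.map_top, Submodule.range_subtype, smul_eq_mul]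
  have hN : Module.length R N = ℓ (𝔪 * I) := by
    rw [coe_idealLength, ← hmap]
    exact (N.equivMapOfInjective I.subtype I.subtype_injective).length_eq
  have hquot : Module.length R (I ⧸ N) = I.spanFinrank := by
    let : Field (R ⧸ 𝔪) := Ideal.Quotient.field 𝔪
    rw [spanFinrank_eq_finrank_quotient I (IsNoetherian.noetherian I),
      Module.length_eq_of_surjective (R := R ⧸ 𝔪) Ideal.Quotient.mk_surjective,
      Module.length_eq_finrank]
  rw [← Nat.cast_inj (R := ℕ∞), Nat.cast_add, ← hN, ← hquot, coe_idealLength]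
  exact (Module.length_eq_add_of_exact _ _ N.subtype_injective N.mkQ_surjective
    (LinearMap.exact_subtype_mkQ N)).symm

lemma minGenerators_eq_sub (I : Ideal R) : minGenerators I = (ℓ I - ℓ (𝔪 * I) : ℕ) := by
  rw [← idealLength_maximalIdeal_mul_add_spanFinrank, Nat.add_sub_cancel_left, minGenerators,
    (IsNoetherian.noetherian I).spanRank_eq_spanFinrank, Cardinal.toENat_nat]

lemma dilworthNumber_le_reesNumber : dilworthNumber R ≤ reesNumber R := by
  refine iSup₂_le fun I _ ↦ le_iInf₂ fun x hx ↦ ?_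
  rw [minGenerators_eq_sub, length_quotient_eq_sub, Nat.cast_le]
  have hle := idealLength_add_idealLength_span_le x I
  have hmono : ℓ (Ideal.span {x} * I) ≤ ℓ (𝔪 * I) :=
    idealLength_mono (Ideal.mul_mono_left ((Ideal.span_singleton_le_iff_mem 𝔪).mpr hx))
  have hx_top := idealLength_mono (le_top : Ideal.span {x} ≤ ⊤)
  omega

lemma isExact_of_span_mul_eq {x : R} (hx : x ∈ 𝔪) (hx0 : x ≠ 0)
    (h : Ideal.span {x} * 𝔪 = 𝔪 ^ 2) : IsExact R := by
  have hlt : 𝔪 ^ 2 < Ideal.span {x} := by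
    rw [← h, mul_comm]
    exact maximalIdeal_mul_lt (Ideal.span_singleton_eq_bot.not.mpr hx0)
  refine dilworthNumber_le_reesNumber.antisymm ?_
  calc reesNumber R ≤ Module.length R (R ⧸ Ideal.span {x}) := iInf₂_le x hx
    _ ≤ minGenerators 𝔪 := by
      rw [minGenerators_eq_sub, length_quotient_eq_sub, Nat.cast_le, ← sq, idealLength_top_eq]
      have := idealLength_strictMono hlt
      omega
    _ ≤ dilworthNumber R := le_iSup₂_of_le 𝔪 le_rfl le_rfl

lemma isExact_of_exists_span_mul_eq (hR : ¬IsField R)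
    (h : ∃ x ∈ 𝔪, Ideal.span {x} * 𝔪 = 𝔪 ^ 2) : IsExact R := by
  obtain ⟨x, hx, hx2⟩ := h
  obtain rfl | hx0 := eq_or_ne x 0
  · obtain ⟨y, hy, hy0⟩ := Submodule.exists_mem_ne_zero_of_ne_bot
      (mt isField_iff_maximalIdeal_eq.mpr hR)
    rw [Ideal.span_singleton_zero, Ideal.bot_mul] at hx2
    exact isExact_of_span_mul_eq hy hy0
      ((span_singleton_mul_le_sq hy).antisymm (hx2 ▸ bot_le))
  · exact isExact_of_span_mul_eq hx hx0 hx2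

lemma idealLength_annihilator_le_of_covBy {I J : Ideal R} (h : J ⋖ I) :
    ℓ J.annihilator ≤ ℓ I.annihilator + ℓ (𝔪).annihilator := by
  obtain ⟨x, hxI, hxJ⟩ := SetLike.exists_of_lt h.lt
  have hsup : J ⊔ Ideal.span {x} = I :=
    (h.eq_or_eq le_sup_left
      (sup_le h.le ((Ideal.span_singleton_le_iff_mem I).mpr hxI))).resolve_left fun h0 ↦
        hxJ ((Ideal.span_singleton_le_iff_mem J).mp (sup_eq_left.mp h0))
  -- Multiplication by `x` embeds `(0 : J) / (0 : I)` into the socle.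
  have hsocle : Ideal.span {x} * J.annihilator ≤ (𝔪).annihilator := by
    rw [Submodule.le_annihilator_iff, smul_eq_mul, mul_right_comm, mul_comm _ 𝔪, ← le_bot_iff]
    calc 𝔪 * Ideal.span {x} * J.annihilator ≤ J * J.annihilator := by
          gcongr
          refine le_trans ?_ (maximalIdeal_mul_le_of_covBy h)
          gcongr
          exact (Ideal.span_singleton_le_iff_mem I).mpr hxI
      _ = ⊥ := Submodule.mul_annihilator J
  rw [← hsup, Submodule.annihilator_sup,
    ← idealLength_inf_annihilator_add_idealLength_span_mul x J.annihilator]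
  gcongr
  exact idealLength_mono hsocle

lemma idealLength_annihilator_add_mul_monotone :
    Monotone fun I : Ideal R ↦ ℓ I.annihilator + ℓ (𝔪).annihilator * ℓ I := by
  intro J I hJI
  induction J using WellFoundedGT.induction with
  | ind J ih =>
    obtain rfl | hlt := hJI.eq_or_lt
    · rfl
    obtain ⟨K, hJK, hKI⟩ := hlt.exists_covby_le
    refine le_trans ?_ (ih K hJK.lt hKI)
    calc ℓ J.annihilator + ℓ (𝔪).annihilator * ℓ J
        ≤ ℓ K.annihilator + ℓ (𝔪).annihilator + ℓ (𝔪).annihilator * ℓ J := by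
          gcongr
          exact idealLength_annihilator_le_of_covBy hJK
      _ = ℓ K.annihilator + ℓ (𝔪).annihilator * (ℓ J + 1) := by ring
      _ ≤ ℓ K.annihilator + ℓ (𝔪).annihilator * ℓ K := by
          gcongr
          exact idealLength_strictMono hJK.lt

lemma idealLength_top_le_annihilator_add_mul (I : Ideal R) :
    ℓ (⊤ : Ideal R) ≤ ℓ I.annihilator + ℓ (𝔪).annihilator * ℓ I := by
  simpa only [Submodule.annihilator_bot, idealLength_bot, mul_zero, add_zero] using
    idealLength_annihilator_add_mul_monotone (bot_le : ⊥ ≤ I)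

lemma idealLength_annihilator_add_mul_le (I : Ideal R) :
    ℓ I.annihilator + ℓ (𝔪).annihilator * ℓ I ≤ ℓ (𝔪).annihilator * ℓ (⊤ : Ideal R) := by
  have hann : (⊤ : Ideal R).annihilator = ⊥ :=
    Submodule.annihilator_top.trans (Module.annihilator_eq_bot.mpr inferInstance)
  simpa only [hann, idealLength_bot, zero_add] using
    idealLength_annihilator_add_mul_monotone (le_top : I ≤ ⊤)

namespace IsGorensteinLocalRing

lemma isAtom_annihilator_maximalIdeal (hR : IsGorensteinLocalRing R) :
    IsAtom (𝔪).annihilator := by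
  obtain ⟨n, hn⟩ := hR
  have hinj := injective_of_hasInjectiveDimensionLE R hn
  refine ⟨fun h0 ↦ ?_, fun I hI ↦ ?_⟩
  · have hle := idealLength_top_le_annihilator_add_mul 𝔪
    simp [h0] at hle
  · by_contra hI0
    obtain ⟨s, hs, hs0⟩ := Submodule.exists_mem_ne_zero_of_ne_bot hI0
    refine hI.not_ge fun t ht ↦ (Ideal.span_singleton_le_iff_mem I).mpr hs
      (mem_span_singleton_of_injective hinj fun a ha ↦ ?_)
    have ha𝔪 : a ∈ 𝔪 := fun hu ↦ hs0 (hu.mul_right_eq_zero.mp ha)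
    rw [mul_comm]
    exact Submodule.mem_annihilator.mp ht a ha𝔪

lemma idealLength_annihilator_maximalIdeal (hR : IsGorensteinLocalRing R) :
    ℓ (𝔪).annihilator = 1 := by
  have := isSimpleModule_iff_isAtom.mpr hR.isAtom_annihilator_maximalIdeal
  rw [idealLength, Module.length_eq_one, ENat.toNat_one]

lemma idealLength_add_idealLength_annihilator (hR : IsGorensteinLocalRing R) (I : Ideal R) :
    ℓ I + ℓ I.annihilator = ℓ (⊤ : Ideal R) := by
  have hle := idealLength_top_le_annihilator_add_mul I
  have hge := idealLength_annihilator_add_mul_le I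
  rw [hR.idealLength_annihilator_maximalIdeal, one_mul] at hle hge
  omega

end IsGorensteinLocalRing

lemma exists_span_mul_eq_of_idealLength_le_sq_add_one (h : ℓ 𝔪 ≤ ℓ (𝔪 ^ 2) + 1) :
    ∃ x ∈ 𝔪, Ideal.span {x} * 𝔪 = 𝔪 ^ 2 := by
  have hle : 𝔪 ^ 2 ≤ 𝔪 := Ideal.pow_le_self two_ne_zero
  obtain ⟨x, hx, hlen⟩ := exists_mem_idealLength_le_sup_span_singleton_add (n := 0) hle h
  have hsup : 𝔪 ^ 2 ⊔ Ideal.span {x} = 𝔪 := eq_of_le_of_idealLength_le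
    (sup_le hle ((Ideal.span_singleton_le_iff_mem 𝔪).mpr hx)) hlen
  refine ⟨x, hx, span_mul_maximalIdeal_eq_of_le_sup hx (le_of_eq ?_)⟩
  calc 𝔪 ^ 2 = (𝔪 ^ 2 ⊔ Ideal.span {x}) * 𝔪 := by rw [hsup, sq]
    _ = Ideal.span {x} * 𝔪 ⊔ 𝔪 ^ 3 := by rw [Ideal.sup_mul, ← pow_succ, sup_comm]

lemma exists_span_mul_eq_of_idealLength_sq_le_cube_add_one (h : ℓ (𝔪 ^ 2) ≤ ℓ (𝔪 ^ 3) + 1) :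
    ∃ x ∈ 𝔪, Ideal.span {x} * 𝔪 = 𝔪 ^ 2 := by
  by_cases hle : 𝔪 ^ 2 ≤ 𝔪 ^ 3
  · exact ⟨0, zero_mem _, span_mul_maximalIdeal_eq_of_le_sup (zero_mem _) (le_sup_of_le_right hle)⟩
  obtain ⟨x, hx, y, hy, hxy⟩ : ∃ x ∈ 𝔪, ∃ y ∈ 𝔪, x * y ∉ 𝔪 ^ 3 := by
    simpa [sq, Ideal.mul_le] using hle
  refine ⟨x, hx, span_mul_maximalIdeal_eq_of_le_sup hx ?_⟩
  have hlt : 𝔪 ^ 3 < Ideal.span {x} * 𝔪 ⊔ 𝔪 ^ 3 := right_lt_sup.mpr fun hle ↦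
    hxy (hle (Ideal.mul_mem_mul (Ideal.mem_span_singleton_self x) hy))
  have hsq : Ideal.span {x} * 𝔪 ⊔ 𝔪 ^ 3 ≤ 𝔪 ^ 2 :=
    sup_le (span_singleton_mul_le_sq hx) (Ideal.pow_le_pow_right (by norm_num))
  have := idealLength_strictMono hlt
  exact (eq_of_le_of_idealLength_le hsq (by omega)).ge

lemma span_mul_maximalIdeal_eq_of_mul_notMem {x y z : R} (hx : x ∈ 𝔪) (hy : y ∈ 𝔪) (hz : z ∈ 𝔪)
    (h : ℓ (𝔪 ^ 2) ≤ ℓ (𝔪 ^ 3) + 2) (hxy : x * y ∉ 𝔪 ^ 3)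
    (hxz : x * z ∉ 𝔪 ^ 3 ⊔ Ideal.span {x * y}) : Ideal.span {x} * 𝔪 = 𝔪 ^ 2 := by
  have hmem {w : R} (hw : w ∈ 𝔪) : x * w ∈ Ideal.span {x} * 𝔪 :=
    Ideal.mul_mem_mul (Ideal.mem_span_singleton_self x) hw
  have hsq {w : R} (hw : w ∈ 𝔪) : x * w ∈ 𝔪 ^ 2 := span_singleton_mul_le_sq hx (hmem hw)
  have hsup : 𝔪 ^ 3 ⊔ Ideal.span {x * y} ⊔ Ideal.span {x * z} = 𝔪 ^ 2 :=
    sup_span_singleton_sup_span_singleton_eq (Ideal.pow_le_pow_right (by norm_num))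
      (hsq hy) (hsq hz) h hxy hxz
  refine span_mul_maximalIdeal_eq_of_le_sup hx ?_
  simp only [← hsup, sup_le_iff, le_sup_right, Ideal.span_singleton_le_iff_mem, true_and]
  exact ⟨Ideal.mem_sup_left (hmem hy), Ideal.mem_sup_left (hmem hz)⟩

lemma exists_span_mul_eq_of_span_pair_sup_eq {a b : R} {J : Ideal R}
    (hspan : Ideal.span {a, b} ⊔ J = 𝔪) (hJ : J * 𝔪 ≤ 𝔪 ^ 3) (h : ℓ (𝔪 ^ 2) ≤ ℓ (𝔪 ^ 3) + 2) :
    ∃ x ∈ 𝔪, Ideal.span {x} * 𝔪 = 𝔪 ^ 2 := by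
  have ha : a ∈ 𝔪 := hspan ▸ Ideal.mem_sup_left (Ideal.subset_span (by simp))
  have hb : b ∈ 𝔪 := hspan ▸ Ideal.mem_sup_left (Ideal.subset_span (by simp))
  by_cases hab : a * b ∈ 𝔪 ^ 3
  · refine ⟨a + b, add_mem ha hb, span_mul_maximalIdeal_eq_of_le_sup (add_mem ha hb) ?_⟩
    have hmem {y : R} (hy : y ∈ 𝔪) : (a + b) * y ∈ Ideal.span {a + b} * 𝔪 ⊔ 𝔪 ^ 3 :=
      Ideal.mem_sup_left (Ideal.mul_mem_mul (Ideal.mem_span_singleton_self _) hy)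
    have hab_mem := Ideal.mem_sup_right (S := Ideal.span {a + b} * 𝔪) hab
    refine sq_le_of_span_pair_sup_eq hspan (le_sup_of_le_right hJ) ?_ hab_mem ?_
    · convert sub_mem (hmem ha) hab_mem using 1
      ring
    · convert sub_mem (hmem hb) hab_mem using 1
      ring
  by_cases haa : a * a ∈ 𝔪 ^ 3 ⊔ Ideal.span {a * b}
  · by_cases hbb : b * b ∈ 𝔪 ^ 3 ⊔ Ideal.span {a * b}
    · have hle : 𝔪 ^ 3 ⊔ Ideal.span {a * b} ≤ Ideal.span {a} * 𝔪 ⊔ 𝔪 ^ 3 :=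
        sup_le le_sup_right (le_sup_of_le_left ((Ideal.span_singleton_le_iff_mem _).mpr
          (Ideal.mul_mem_mul (Ideal.mem_span_singleton_self a) hb)))
      have hab_mem := Ideal.mem_sup_right (S := 𝔪 ^ 3) (Ideal.mem_span_singleton_self (a * b))
      exact ⟨a, ha, span_mul_maximalIdeal_eq_of_le_sup ha <|
        sq_le_of_span_pair_sup_eq hspan (le_sup_of_le_right hJ) (hle haa) (hle hab_mem) (hle hbb)⟩
    · rw [mul_comm a b] at hab hbb
      exact ⟨b, hb, span_mul_maximalIdeal_eq_of_mul_notMem hb ha hb h hab hbb⟩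
  · exact ⟨a, ha, span_mul_maximalIdeal_eq_of_mul_notMem ha hb ha h hab haa⟩

lemma exists_span_mul_eq_of_mul_le_cube {J : Ideal R} (hJ𝔪 : J ≤ 𝔪) (hJ : J * 𝔪 ≤ 𝔪 ^ 3)
    (h1 : ℓ 𝔪 ≤ ℓ J + 2) (h2 : ℓ (𝔪 ^ 2) ≤ ℓ (𝔪 ^ 3) + 2) :
    ∃ x ∈ 𝔪, Ideal.span {x} * 𝔪 = 𝔪 ^ 2 := by
  obtain ⟨a, ha, hlen_a⟩ := exists_mem_idealLength_le_sup_span_singleton_add hJ𝔪 h1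
  have hJa : J ⊔ Ideal.span {a} ≤ 𝔪 := sup_le hJ𝔪 ((Ideal.span_singleton_le_iff_mem 𝔪).mpr ha)
  obtain ⟨b, hb, hlen_b⟩ :=
    exists_mem_idealLength_le_sup_span_singleton_add (n := 0) hJa hlen_a
  have hsup : J ⊔ Ideal.span {a} ⊔ Ideal.span {b} = 𝔪 := eq_of_le_of_idealLength_le
    (sup_le hJa ((Ideal.span_singleton_le_iff_mem 𝔪).mpr hb)) hlen_b
  refine exists_span_mul_eq_of_span_pair_sup_eq (a := a) (b := b) ?_ hJ h2
  rw [Ideal.span_insert, sup_comm, ← sup_assoc, hsup]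

namespace IsGorensteinLocalRing

lemma exists_span_mul_eq_of_pow_four_eq_bot (hR : IsGorensteinLocalRing R) (h4 : 𝔪 ^ 4 = ⊥)
    (h2 : ℓ (𝔪 ^ 3) + 2 ≤ ℓ (𝔪 ^ 2)) (hlen : ℓ (⊤ : Ideal R) ≤ 7) :
    ∃ x ∈ 𝔪, Ideal.span {x} * 𝔪 = 𝔪 ^ 2 := by
  have hsocle := hR.idealLength_annihilator_maximalIdeal
  have hle_annihilator {i j : ℕ} (hij : 𝔪 ^ (i + j) = ⊥) : 𝔪 ^ i ≤ (𝔪 ^ j).annihilator := by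
    rw [Submodule.le_annihilator_iff, smul_eq_mul, ← pow_add, hij]
  have hcube_le : 𝔪 ^ 3 ≤ (𝔪).annihilator := by
    simpa only [pow_one] using hle_annihilator (i := 3) (j := 1) h4
  have hcube : 𝔪 ^ 3 ≠ ⊥ := fun h3 ↦ by
    have hsq_le := idealLength_mono (hle_annihilator (i := 2) (j := 1) h3)
    rw [pow_one] at hsq_le
    omega
  have hcube_eq : 𝔪 ^ 3 = (𝔪).annihilator :=
    (hR.isAtom_annihilator_maximalIdeal.le_iff.mp hcube_le).resolve_left hcube
  have hsq := idealLength_mono (hle_annihilator (i := 2) (j := 2) h4)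
  have hdual := hR.idealLength_add_idealLength_annihilator (𝔪 ^ 2)
  have htop := idealLength_top_eq (R := R)
  rw [hcube_eq] at h2
  -- As `𝔪³` is the socle, it contains `(0 : 𝔪²)𝔪`.
  refine exists_span_mul_eq_of_mul_le_cube (J := (𝔪 ^ 2).annihilator) ?_ ?_ (by omega) ?_
  · refine le_maximalIdeal fun h0 ↦ ?_
    rw [h0] at hdual
    omega
  · rw [hcube_eq, Submodule.le_annihilator_iff, smul_eq_mul, mul_assoc, ← sq]
    exact Submodule.annihilator_mul _
  · rw [hcube_eq]
    omega

lemma exists_span_mul_eq (hR : IsGorensteinLocalRing R) (hlen : ℓ (⊤ : Ideal R) ≤ 7) :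
    ∃ x ∈ 𝔪, Ideal.span {x} * 𝔪 = 𝔪 ^ 2 := by
  by_cases h1 : ℓ 𝔪 ≤ ℓ (𝔪 ^ 2) + 1
  · exact exists_span_mul_eq_of_idealLength_le_sq_add_one h1
  by_cases h2 : ℓ (𝔪 ^ 2) ≤ ℓ (𝔪 ^ 3) + 1
  · exact exists_span_mul_eq_of_idealLength_sq_le_cube_add_one h2
  by_cases h4 : 𝔪 ^ 4 = ⊥
  · exact hR.exists_span_mul_eq_of_pow_four_eq_bot h4 (by omega) hlen
  have h3 : 𝔪 ^ 4 < 𝔪 ^ 3 := by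
    rw [pow_succ' _ 3]
    exact maximalIdeal_mul_lt fun h3 ↦ h4 (by rw [pow_succ, h3, Ideal.bot_mul])
  have hlen3 := idealLength_strictMono h3
  have hlen4 := idealLength_eq_zero.not.mpr h4
  have htop := idealLength_top_eq (R := R)
  -- The Hilbert function is `(1, 2, 2, 1, 1)`.
  exact exists_span_mul_eq_of_mul_le_cube (Ideal.pow_le_self two_ne_zero) (pow_succ 𝔪 2).ge
    (by omega) (by omega)

end IsGorensteinLocalRing

end LocalRing

theorem mainTheorem5_general {R : Type*} [CommRing R] [IsLocalRing R] [IsArtinianRing R]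
    (hGor : IsGorensteinLocalRing R) (hfield : ¬ IsField R) (hlen : Module.length R R ≤ 7) :
    IsLocalRing.IsExact R := by
  rw [← coe_idealLength_top] at hlen
  exact isExact_of_exists_span_mul_eq hfield (hGor.exists_span_mul_eq (by exact_mod_cast hlen))

theorem mainTheorem5 (k : Type*) [Field k] [IsAlgClosed k] [CharZero k]
    (R : Type*) [CommRing R] [IsLocalRing R] [IsArtinianRing R] [Algebra k R]
    (hGor : IsGorensteinLocalRing R) (hfield : ¬ IsField R)
    (hlen : Module.length R R ≤ 7) :
    IsLocalRing.IsExact R :=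
  mainTheorem5_general hGor hfield hlen
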